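/- Let $M$ be a finite-dimensional smooth Riemannian manifold (not assumed complete) with metric $g$ and distance $d_g$ (equal to $+\infty$ between points of different components), let $\mathcal U\subset M$ be closed, let $(E,d_E)$ be a metric space, and let $P:E\times M\to[0,\infty)$. For $e\in E$ put $\mathcal A(e)=\{q\in\mathcal U: P(e,q)=0\}$, and let $e_0\in E$, $q_0\in\mathcal A(e_0)$. For $f:M\to\mathbb R\cup\{\infty\}$ and $q$ with $f(q)<\infty$, a covector $p\in T_q^*M$ is a Fréchet subgradient of $f$ at $q$ if $p=dh(q)$ for some $C^1$ function $h:M\to\mathbb R$ such that $f-h$ has a local minimum at $q$; it is a limiting subgradient of $f$ at $q$ if there are $q_n\to q$ and Fréchet subgradients $p_n$ of $f$ at $q_n$ with $f(q_n)\to f(q)$ and $p_n\to p$ in $T^*M$. For $q\in\mathcal U$, the limiting normal cone $N^L_{\mathcal U}(q)$ is the set of limiting subgradients at $q$ of the function equal to $0$ on $\mathcal U$ and $\infty$ off $\mathcal U$, and the Clarke tangent cone is $T^C_{\mathcal U}(q)=\{v\in T_qM:\langle p,v\rangle\le 0\ \text{for all } p\in N^L_{\mathcal U}(q)\}$. Suppose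 that 1. $P$ is jointly continuous on $E\times M$; 2. $P$ is locally Lipschitz in $q$ near $(e_0,q_0)$: for all $(e,q)$ in some neighborhood of $(e_0,q_0)$ in $E\times M$, the function $P(e,\cdot)$ is Lipschitz on a neighborhood of $q$ (with a constant that may depend on $(e,q)$); 3. $P$ satisfies the strong decrease condition for $\mathcal U$ near $q_0$ with constant $\Delta>0$: there is $\varepsilon>0$ such that for every $(e,q)\in E\times\mathcal U$ with $P(e,q)>0$ and $d_g(q,q_0)+d_E(e,e_0)<\varepsilon$ there are a nonzero $v\in T^C_{\mathcal U}(q)$ and a smooth curve $c:\mathbb R\to M$ with $c(0)=q$, $c'(0)=v$ and $$\liminf_{\lambda\downarrow0}\frac{P(e,c(\lambda))-P(e,q)}{\lambda}\le-\Delta\|v\|_g .$$ (When $P(e,\cdot)$ is Lipschitz near $q$, the left side does not depend on the choice of $c$.) Then there is a neighborhood $\mathcal O$ of $(e_0,q_0)$ in $E\times\mathcal U$ such that for all $(e,q)\in\mathcal O$ the set $\mathcal A(e)$ is nonempty and $$d_{\mathcal A(e)}(q):=\inf\{d_g(q,a):a\in\mathcal A(e)\}\le\frac1\Delta P(e,q).$$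 In particular, $\mathcal A(e)$ is nonempty for all $e$ in a neighborhood of $e_0$. -/

import Mathlib

open Set Filter Topology
open scoped Manifold ContDiff Bundle ENNReal NNReal

namespace NonsmoothManifold

noncomputable section

section Nonsmooth

variable {F : Type*} [NormedAddCommGroup F] [NormedSpace ℝ F]
  {H : Type*} [TopologicalSpace H] (I : ModelWithCorners ℝ F H)
  {M : Type*} [TopologicalSpace M] [ChartedSpace H M]

/-- The cotangent space `T*_q M`. -/
abbrev CotangentSpace (q : M) : Type _ := TangentSpace I q →L[ℝ] ℝ

variable (M) in
/-- The cotangent bundle `T*M`, with Mathlib's topology on the bundle of continuous linear maps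
from the tangent bundle to the trivial line bundle. -/
abbrev CotangentBundle : Type _ :=
  Bundle.TotalSpace (F →L[ℝ] ℝ) (fun q : M => TangentSpace I q →L[ℝ] ℝ)

/-- The Fréchet subdifferential at `q` of `f : M → ℝ ∪ {∞}`: all covectors `dg(q)`, where `g` is a
`C¹` function on `M` such that `f - g` has a local minimum at `q`. As usual it is empty outside the
domain `{f < ∞}` of `f`. -/
def frechetSubdifferential (f : M → EReal) (q : M) : Set (CotangentSpace I q) :=
  {p | f q ≠ ⊤ ∧ ∃ g : M → ℝ, ContMDiff I 𝓘(ℝ, ℝ) 1 g ∧ p = mvfderiv I g q ∧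
    IsLocalMin (fun x => f x - (g x : EReal)) q}

variable [IsManifold I 1 M]

/-- The limiting subdifferential at `q`: limits in the cotangent bundle of Fréchet subgradients
`pₙ` of `f` at points `qₙ → q` with `f qₙ → f q`. -/
def limitingSubdifferential (f : M → EReal) (q : M) : Set (CotangentSpace I q) :=
  {p | ∃ (qs : ℕ → M) (ps : ∀ n, CotangentSpace I (qs n)),
    (∀ n, ps n ∈ frechetSubdifferential I f (qs n)) ∧
    Tendsto qs atTop (𝓝 q) ∧
    Tendsto (fun n => f (qs n)) atTop (𝓝 (f q)) ∧
    Tendsto (fun n => (⟨qs n, ps n⟩ : CotangentBundle I M)) atTop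
      (𝓝 (⟨q, p⟩ : CotangentBundle I M))}

open scoped Classical in
/-- The function `χ_S`, equal to `0` on `S` and to `∞` off `S`. -/
def convexIndicator (S : Set M) (q : M) : EReal := if q ∈ S then 0 else ⊤

/-- The limiting normal cone to `S` at `q ∈ S`. -/
def limitingNormalCone (S : Set M) (q : M) : Set (CotangentSpace I q) :=
  limitingSubdifferential I (convexIndicator S) q

/-- The Clarke tangent cone to `S` at `q ∈ S`: the polar of the limiting normal cone. -/
def clarkeTangentCone (S : Set M) (q : M) : Set (TangentSpace I q) :=
  {v | ∀ p ∈ limitingNormalCone I S q, p v ≤ 0}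

/-- `c : ℝ → M` is a smooth curve with `c(0) = q` and `c'(0) = v`. The last two equations are
written as one equation in the tangent bundle. -/
def IsSmoothCurveWithVelocity (c : ℝ → M) (q : M) (v : TangentSpace I q) : Prop :=
  ContMDiff 𝓘(ℝ, ℝ) I ∞ c ∧
    tangentMap 𝓘(ℝ, ℝ) I c (⟨0, (1 : ℝ)⟩ : TangentBundle 𝓘(ℝ, ℝ) ℝ) = (⟨q, v⟩ : TangentBundle I M)

end Nonsmooth

/-- `liminf_{t ↓ 0} (f (c t) - f (c 0)) / t`, as an extended real number. -/
def lowerDiniAlong {M : Type*} (f : M → ℝ) (c : ℝ → M) : EReal :=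
  liminf (fun t : ℝ => (((f (c t) - f (c 0)) / t : ℝ) : EReal)) (𝓝[>] (0 : ℝ))

/-- The set `A(e)` of points of `U` at which `P e` vanishes. -/
def zeroSet {X M : Type*} (P : X → M → ℝ) (U : Set M) (e : X) : Set M :=
  {q | q ∈ U ∧ P e q = 0}

/-- The strong decrease condition for `U` near `q₀`, at the parameter `e₀`, with constant `Δ`.
For `P e` Lipschitz near `q` the lower derivative is the same along all smooth curves with
velocity `v`; the existence of one is asked for. -/
def StrongDecrease {F : Type*} [NormedAddCommGroup F] [NormedSpace ℝ F]
    {H : Type*} [TopologicalSpace H] (I : ModelWithCorners ℝ F H)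
    {M : Type*} [EMetricSpace M] [ChartedSpace H M] [IsManifold I 1 M]
    [Bundle.RiemannianBundle (fun x : M => TangentSpace I x)]
    {X : Type*} [MetricSpace X]
    (P : X → M → ℝ) (U : Set M) (e₀ : X) (q₀ : M) (Δ : ℝ) : Prop :=
  0 < Δ ∧ ∃ ε : ℝ, 0 < ε ∧ ∀ (e : X) (q : M), q ∈ U → 0 < P e q →
    edist q q₀ + edist e e₀ < ENNReal.ofReal ε →
    ∃ v ∈ clarkeTangentCone I U q, v ≠ 0 ∧
      ∃ c : ℝ → M, IsSmoothCurveWithVelocity I c q v ∧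
        lowerDiniAlong (P e) c ≤ ((-(Δ * ‖v‖) : ℝ) : EReal)

end

end NonsmoothManifold

/-! Fix a rate `Δ' < Δ` and `(e, q)` near `(e₀, q₀)` with `q ∈ U`, and minimize `P e y + Δ' * d(y,
q)` over the part of `U` in a compact neighbourhood of `q₀`. Local compactness supplies the
minimizer `x` that Ekeland's principle would give on a complete space. Comparison with `y = q` gives
`Δ' * d(x, q) ≤ P e q`, which is small, so `x` is close to `q₀`. By the triangle inequality `x`
locally minimizes `P e + Δ' * d(·, x)` on `U`. If `P e x > 0`, strong decrease provides a Clarke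
tangent direction with rate at least `Δ`, contradicting `Δ' < Δ`. Hence `x` is a zero with `Δ' *
d(x, q) ≤ P e q`; let `Δ'` tend to `Δ`.

The contradiction (`decrease_rate_le_of_local_min`) needs points of `U` within `o(t)` of the curve
`c t`: the Lipschitz property of `P e` then transfers the decrease along `c` to `U`. Such points
exist because Clarke tangent vectors are derivable. In a Euclidean chart
(`eventually_infDist_le_of_polar`), the distance from `a + t • w` to the closed set grows at a rate
at most the inner product of `w` with a unit proximal normal. Limits of these normals are limiting
normals (`inner_comp_mem_limitingNormalCone`), to which `w` is polar, so the growth rate is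
eventually below any `ε > 0`. -/

namespace NonsmoothManifold

/-! ### Polar vectors are derivable: the Euclidean case. -/

section Euclidean

variable {V : Type*} [NormedAddCommGroup V] [InnerProductSpace ℝ V]

open scoped RealInnerProductSpace

/-- The derivative of the distance from a moving point `a + s • w` to a fixed point. -/
theorem hasDerivAt_norm_add_smul_sub {a w y : V} {t : ℝ} (h : a + t • w ≠ y) :
    HasDerivAt (fun s : ℝ => ‖a + s • w - y‖)
      ⟪‖a + t • w - y‖⁻¹ • (a + t • w - y), w⟫ t := by
  have hne : a + t • w - y ≠ 0 := sub_ne_zero.2 h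
  have h1 : HasDerivAt (fun s : ℝ => a + s • w - y) w t := by
    simpa using (((hasDerivAt_id t).smul_const w).const_add a).sub_const y
  have h2 := h1.norm_sq.sqrt (by positivity)
  simp only [Real.sqrt_sq (norm_nonneg _)] at h2
  convert h2 using 1
  rw [real_inner_smul_left]
  field_simp

variable [FiniteDimensional ℝ V]

/-- If `w` is polar to all limits at `a` of unit proximal normals to the closed set `S`,
then near `t = 0⁺` proximal normals at projections of `a + t • w` make a small inner product
with `w`. -/
theorem eventually_inner_proximal_lt {S : Set V} {a w : V} (ha : a ∈ S)
    (H : ∀ (y z : ℕ → V) (u : V), (∀ n, y n ∈ S) →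
      (∀ n, ∀ s ∈ S, dist (z n) (y n) ≤ dist (z n) s) → (∀ n, z n ≠ y n) →
      Tendsto y atTop (𝓝 a) →
      Tendsto (fun n => ‖z n - y n‖⁻¹ • (z n - y n)) atTop (𝓝 u) → ⟪u, w⟫ ≤ 0)
    {ε : ℝ} (hε : 0 < ε) :
    ∃ δ > 0, ∀ t ∈ Ico (0 : ℝ) δ, ∀ y ∈ S, (∀ s ∈ S, dist (a + t • w) y ≤ dist (a + t • w) s) →
      a + t • w ≠ y → ⟪‖a + t • w - y‖⁻¹ • (a + t • w - y), w⟫ < ε := by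
  -- A failure for every `δ` gives `t n → 0` and projections `y n → a`, since `y n` is no farther
  -- from `a + t n • w` than `a` is. Compactness of the unit sphere then yields a limiting normal
  -- `u'` with inner product at least `ε`.
  by_contra! hcon
  choose t ht y hyS hy hne hle using fun n : ℕ => hcon (1 / ((n : ℝ) + 1)) (by positivity)
  have ht0 : Tendsto t atTop (𝓝 0) :=
    squeeze_zero (fun n => (ht n).1) (fun n => (ht n).2.le) tendsto_one_div_add_atTop_nhds_zero_nat
  have hz : Tendsto (fun n => a + t n • w) atTop (𝓝 a) := by
    simpa using (ht0.smul_const w).const_add a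
  have hya : Tendsto y atTop (𝓝 a) := by
    have h1 : Tendsto (fun n => dist (a + t n • w) (y n)) atTop (𝓝 0) :=
      squeeze_zero (fun _ => dist_nonneg) (fun n => hy n a ha)
        (by simpa using hz.dist (tendsto_const_nhds (x := a)))
    have h2 := h1.add (hz.dist (tendsto_const_nhds (x := a)))
    rw [dist_self, add_zero] at h2
    refine tendsto_iff_dist_tendsto_zero.2 (squeeze_zero (fun _ => dist_nonneg) (fun n => ?_) h2)
    rw [dist_comm (a + t n • w) (y n)]
    exact dist_triangle _ _ _
  set u : ℕ → V := fun n => ‖a + t n • w - y n‖⁻¹ • (a + t n • w - y n) with hu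
  have hsph : ∀ n, u n ∈ Metric.sphere (0 : V) 1 := fun n => by
    have : a + t n • w - y n ≠ 0 := sub_ne_zero.2 (hne n)
    simp [hu, norm_smul, this]
  obtain ⟨u', -, φ, hφ, hlim⟩ := (isCompact_sphere (0 : V) 1).tendsto_subseq hsph
  have h0 := H (y ∘ φ) (fun n => a + t (φ n) • w) u' (fun n => hyS _) (fun n => hy _)
    (fun n => hne _) (hya.comp hφ.tendsto_atTop) hlim
  have h1 : ε ≤ ⟪u', w⟫ :=
    ge_of_tendsto' (hlim.inner (tendsto_const_nhds (x := w))) fun n => hle (φ n)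
  linarith

/-- In a Euclidean space, a vector `w` that is polar to all limits at `a` of unit proximal normals
to the closed set `S` is derivable: `a + t • w` has distance `o(t)` to `S` as `t ↓ 0`. -/
theorem eventually_infDist_le_of_polar {S : Set V} (hS : IsClosed S) {a w : V} (ha : a ∈ S)
    (H : ∀ (y z : ℕ → V) (u : V), (∀ n, y n ∈ S) →
      (∀ n, ∀ s ∈ S, dist (z n) (y n) ≤ dist (z n) s) → (∀ n, z n ≠ y n) →
      Tendsto y atTop (𝓝 a) →
      Tendsto (fun n => ‖z n - y n‖⁻¹ • (z n - y n)) atTop (𝓝 u) → ⟪u, w⟫ ≤ 0)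
    {ε : ℝ} (hε : 0 < ε) :
    ∀ᶠ t in 𝓝[>] (0 : ℝ), Metric.infDist (a + t • w) S ≤ ε * t := by
  obtain ⟨δ, hδ, hproj⟩ := eventually_inner_proximal_lt ha H (half_pos hε)
  set f : ℝ → ℝ := fun t => Metric.infDist (a + t • w) S with hf
  have hfc : Continuous f := (Metric.continuous_infDist_pt S).comp (by fun_prop)
  -- The barrier criterion compares slopes only where `f` meets the barrier. The slack `η` makes `f`
  -- positive there, so the slope bound is `ε / 2 < ε`; the bound `‖w‖` at zeros of `f` never enters
  -- the comparison.
  have key : ∀ η > 0, ∀ t ∈ Ico 0 δ, f t ≤ ε * t + η := by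
    intro η hη t ht
    refine image_le_of_liminf_slope_right_lt_deriv_boundary (f := f) (a := 0) (b := t)
      (f' := fun x => if 0 < f x then ε / 2 else ‖w‖) (B := fun t => ε * t + η) (B' := fun _ => ε)
      hfc.continuousOn ?_ ?_ ?_ ?_ (right_mem_Icc.2 ht.1)
    · intro x hx r hr
      obtain ⟨y, hyS, hy⟩ := hS.exists_infDist_eq_dist ⟨a, ha⟩ (a + x • w)
      -- Freezing the projection `y` of the point at time `x` gives an upper bound for `f` with
      -- equality at `x`.
      have hslope : ∀ z > x, slope f x z ≤ slope (fun s : ℝ => ‖a + s • w - y‖) x z := by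
        intro z hz
        have h1 : f z ≤ ‖a + z • w - y‖ := by
          rw [← dist_eq_norm]; exact Metric.infDist_le_dist_of_mem hyS
        have h2 : f x = ‖a + x • w - y‖ := by rw [← dist_eq_norm]; exact hy
        rw [slope_def_field, slope_def_field, h2]
        exact div_le_div_of_nonneg_right (by linarith) (by linarith)
      by_cases hfx : 0 < f x
      · simp only [hfx, if_true] at hr
        have hne : a + x • w ≠ y := fun h => hfx.ne' (by rw [hf]; simp only; rw [hy, h, dist_self])
        have hlt := hproj x ⟨hx.1, hx.2.trans ht.2⟩ y hyS
          (fun s hs => hy ▸ Metric.infDist_le_dist_of_mem hs) hne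
        have := (hasDerivAt_norm_add_smul_sub hne).hasDerivWithinAt (s := Ici x) |>.liminf_right_slope_le
          (hlt.trans hr)
        exact (this.and_eventually self_mem_nhdsWithin).mono
          fun z hz => (hslope z hz.2).trans_lt hz.1
      · simp only [hfx, if_false] at hr
        have h0 : f x = 0 := le_antisymm (not_lt.1 hfx) Metric.infDist_nonneg
        refine Eventually.frequently (eventually_of_mem self_mem_nhdsWithin fun z hz => ?_)
        refine lt_of_le_of_lt ?_ hr
        have hz : x < z := hz
        rw [slope_def_field, div_le_iff₀ (by linarith)]
        have h3 : f z ≤ f x + dist (a + z • w) (a + x • w) := Metric.infDist_le_infDist_add_dist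
        have h4 : dist (a + z • w) (a + x • w) = ‖w‖ * (z - x) := by
          rw [dist_add_left, dist_eq_norm, ← sub_smul, norm_smul, Real.norm_of_nonneg (by linarith),
            mul_comm]
        linarith
    · simp [hf, Metric.infDist_zero_of_mem ha, hη.le]
    · intro x
      simpa using ((hasDerivAt_id x).const_mul ε).add_const η
    · intro x hx hfx
      have : 0 < f x := by rw [hfx]; have := mul_nonneg hε.le hx.1; linarith
      simp only [this, if_true]
      linarith
  filter_upwards [Ioo_mem_nhdsGT hδ] with t ht
  exact le_of_forall_pos_le_add fun η hη => key η hη t ⟨ht.1.le, ht.2⟩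

end Euclidean

/-! ### Riemannian distance against chart distance and speed. -/

section Riemannian

variable {F : Type*} [NormedAddCommGroup F] [NormedSpace ℝ F]
  {M : Type*} [EMetricSpace M] [ChartedSpace F M]
  [Bundle.RiemannianBundle (fun x : M => TangentSpace 𝓘(ℝ, F) x)]
  [IsRiemannianManifold 𝓘(ℝ, F) M]

/-- A curve that is `C¹` and whose speed is at most `L` on `(a, b)` moves by at most
`L * (b - a)`. -/
theorem edist_le_of_enorm_mfderiv_le {γ : ℝ → M} {a b : ℝ} (hab : a ≤ b) {L : ℝ≥0∞}
    (hγ : ContMDiffOn 𝓘(ℝ, ℝ) 𝓘(ℝ, F) 1 γ (Icc a b))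
    (hL : ∀ t ∈ Ioo a b, ‖mfderiv 𝓘(ℝ, ℝ) 𝓘(ℝ, F) γ t (1 : ℝ)‖ₑ ≤ L) :
    edist (γ a) (γ b) ≤ L * ENNReal.ofReal (b - a) := by
  rw [IsRiemannianManifold.out (I := 𝓘(ℝ, F)) (γ a) (γ b)]
  refine (Manifold.riemannianEDist_le_pathELength hγ rfl rfl hab).trans ?_
  rw [Manifold.pathELength_eq_lintegral_mfderiv_Ioo]
  refine (MeasureTheory.setLIntegral_mono' measurableSet_Ioo hL).trans ?_
  simp

variable [IsManifold 𝓘(ℝ, F) 1 M]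
  [IsContinuousRiemannianBundle F (fun x : M => TangentSpace 𝓘(ℝ, F) x)]

/-- Around any point, the Riemannian distance is controlled by the distance in the chart. -/
theorem exists_edist_le_edist_extChartAt (x : M) :
    ∃ C : ℝ≥0, ∃ s ∈ 𝓝 x, ∀ y ∈ s, ∀ z ∈ s,
      edist y z ≤ C * edist (extChartAt 𝓘(ℝ, F) x y) (extChartAt 𝓘(ℝ, F) x z) := by
  obtain ⟨C, C_pos, hC⟩ := eventually_norm_symmL_trivializationAt_lt F
    (fun x : M => TangentSpace 𝓘(ℝ, F) x) x
  have hsymm : ContinuousAt (extChartAt 𝓘(ℝ, F) x).symm (extChartAt 𝓘(ℝ, F) x x) :=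
    continuousAt_extChartAt_symm x
  have hC' : ∀ᶠ w in 𝓝 (extChartAt 𝓘(ℝ, F) x x), ‖(trivializationAt F
      (fun x : M => TangentSpace 𝓘(ℝ, F) x) x).symmL ℝ ((extChartAt 𝓘(ℝ, F) x).symm w)‖ < C := by
    rw [ContinuousAt, extChartAt_to_inv] at hsymm
    exact hsymm hC
  obtain ⟨r, r_pos, hr⟩ := Metric.mem_nhds_iff.1
    (inter_mem (extChartAt_target_mem_nhds (I := 𝓘(ℝ, F)) x) hC')
  refine ⟨C.toNNReal, (extChartAt 𝓘(ℝ, F) x).source ∩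
    extChartAt 𝓘(ℝ, F) x ⁻¹' Metric.ball (extChartAt 𝓘(ℝ, F) x x) r,
    inter_mem (extChartAt_source_mem_nhds x)
      ((continuousAt_extChartAt x).preimage_mem_nhds (Metric.ball_mem_nhds _ r_pos)), ?_⟩
  rintro y ⟨hys, hyr⟩ z ⟨hzs, hzr⟩
  set φ := extChartAt 𝓘(ℝ, F) x with hφ
  -- The pulled-back chart segment is a competitor for the Riemannian distance; its speed is
  -- controlled by the trivialization's inverse, bounded by `C` near `x`.
  let η : ℝ → F := fun t => φ y + t • (φ z - φ y)
  have hη : ∀ t ∈ Icc (0 : ℝ) 1, η t ∈ Metric.ball (φ x) r := fun t ht =>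
    (convex_ball _ _).add_smul_sub_mem hyr hzr ht
  have hηs : ContMDiff 𝓘(ℝ, ℝ) 𝓘(ℝ, F) 1 η := by
    rw [contMDiff_iff_contDiff]; fun_prop
  have hγ : ContMDiffOn 𝓘(ℝ, ℝ) 𝓘(ℝ, F) 1 (φ.symm ∘ η) (Icc 0 1) :=
    (contMDiffOn_extChartAt_symm x).comp hηs.contMDiffOn fun t ht => (hr (hη t ht)).1
  have hmain := edist_le_of_enorm_mfderiv_le (M := M) zero_le_one hγ
    (L := C.toNNReal * edist (φ y) (φ z)) ?_
  · simpa [η, φ.left_inv hys, φ.left_inv hzs] using hmain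
  intro t ht
  obtain ⟨htt, htC⟩ := hr (hη t (Ioo_subset_Icc_self ht))
  have hsrc : φ.symm (η t) ∈ (chartAt F x).source := by
    rw [← extChartAt_source 𝓘(ℝ, F)]; exact φ.map_target htt
  have hd : MDifferentiableAt 𝓘(ℝ, F) 𝓘(ℝ, F) φ.symm (η t) :=
    (mdifferentiableWithinAt_extChartAt_symm htt).mdifferentiableAt (by simp)
  have hcomp : mfderiv 𝓘(ℝ, ℝ) 𝓘(ℝ, F) (φ.symm ∘ η) t (1 : ℝ) =
      (trivializationAt F (fun x : M => TangentSpace 𝓘(ℝ, F) x) x).symmL ℝ (φ.symm (η t))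
        (φ z - φ y) := by
    rw [mfderiv_comp t hd ((hηs t).mdifferentiableAt one_ne_zero),
      TangentBundle.symmL_trivializationAt hsrc, φ.right_inv htt]
    have hη' : mfderiv 𝓘(ℝ, ℝ) 𝓘(ℝ, F) η t (1 : ℝ) = φ z - φ y := by
      have : HasDerivAt η (φ z - φ y) t := by
        simpa only [one_smul, id_eq] using ((hasDerivAt_id t).smul_const (φ z - φ y)).const_add (φ y)
      rw [mfderiv_eq_fderiv]
      exact this.deriv
    simp only [modelWithCornersSelf_coe, range_id, mfderivWithin_univ]
    exact congrArg (mfderiv 𝓘(ℝ, F) 𝓘(ℝ, F) φ.symm (η t)) hη'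
  rw [hcomp, edist_comm, edist_eq_enorm_sub]
  refine (ContinuousLinearMap.le_opENorm _ _).trans ?_
  gcongr
  rw [← ofReal_norm]
  exact ENNReal.ofReal_le_ofReal htC.le

/-- The initial speed of a smooth curve bounds its initial rate of displacement. -/
theorem IsSmoothCurveWithVelocity.eventually_edist_le {c : ℝ → M} {q : M}
    {v : TangentSpace 𝓘(ℝ, F) q} (hc : IsSmoothCurveWithVelocity 𝓘(ℝ, F) c q v)
    {L : ℝ} (hL : ‖v‖ < L) :
    ∀ᶠ t in 𝓝[>] (0 : ℝ), edist (c t) q ≤ ENNReal.ofReal (L * t) := by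
  obtain ⟨hsm, hv⟩ := hc
  have hsm : ContMDiff 𝓘(ℝ, ℝ) 𝓘(ℝ, F) 1 c := hsm.of_le (by norm_cast)
  have h1 : Continuous fun t : ℝ => (⟨c t, mfderiv 𝓘(ℝ, ℝ) 𝓘(ℝ, F) c t (1 : ℝ)⟩ :
      TangentBundle 𝓘(ℝ, F) M) := by
    refine (hsm.continuous_tangentMap le_rfl).comp
      (g := tangentMap 𝓘(ℝ, ℝ) 𝓘(ℝ, F) c)
      (f := fun t : ℝ => (⟨t, (1 : ℝ)⟩ : TangentBundle 𝓘(ℝ, ℝ) ℝ)) ?_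
    exact (tangentBundleModelSpaceHomeomorph 𝓘(ℝ, ℝ)).symm.continuous.comp
      (by fun_prop : Continuous fun t : ℝ => ((t, 1) : ℝ × ℝ))
  have h2 : Continuous fun t : ℝ => ‖mfderiv 𝓘(ℝ, ℝ) 𝓘(ℝ, F) c t (1 : ℝ)‖ := by
    simp_rw [norm_eq_sqrt_real_inner]
    exact (h1.inner_bundle h1).sqrt
  have h3 : ‖mfderiv 𝓘(ℝ, ℝ) 𝓘(ℝ, F) c 0 (1 : ℝ)‖ < L := by
    have h4 : (fun z : TangentBundle 𝓘(ℝ, F) M => ‖z.2‖)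
      (tangentMap 𝓘(ℝ, ℝ) 𝓘(ℝ, F) c ⟨0, (1 : ℝ)⟩) = ‖v‖ := by rw [hv]
    exact h4.trans_lt hL
  have hc0 : c 0 = q := congrArg Bundle.TotalSpace.proj hv
  obtain ⟨δ, hδ, hball⟩ := Metric.eventually_nhds_iff_ball.1
    (h2.continuousAt.eventually_lt_const h3)
  filter_upwards [Ioo_mem_nhdsGT hδ] with t ht
  have hmain := edist_le_of_enorm_mfderiv_le (M := M) ht.1.le hsm.contMDiffOn
    (L := ENNReal.ofReal L) fun s hs => by
      rw [← ofReal_norm]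
      refine ENNReal.ofReal_le_ofReal (hball s ?_).le
      rw [Real.ball_eq_Ioo]
      exact ⟨by linarith [hs.1], by linarith [hs.2, ht.2]⟩
  rwa [hc0, sub_zero, ← ENNReal.ofReal_mul ((norm_nonneg v).trans hL.le), edist_comm] at hmain

end Riemannian

/-! ### Cotangent convergence, curve velocities and Fréchet normals in charts. -/

section NormalCone

variable {F : Type*} [NormedAddCommGroup F] [NormedSpace ℝ F]
  {M : Type*} [TopologicalSpace M] [ChartedSpace F M] [IsManifold 𝓘(ℝ, F) 1 M]

/-- The trivialization at `x` of the cotangent bundle, on covectors read in that trivialization. -/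
theorem trivializationAt_cotangentBundle_mk {x y : M} (hy : y ∈ (trivializationAt F
      (fun x : M => TangentSpace 𝓘(ℝ, F) x) x).baseSet) (k : F →L[ℝ] ℝ) :
    trivializationAt (F →L[ℝ] ℝ) (fun q : M => TangentSpace 𝓘(ℝ, F) q →L[ℝ] ℝ) x
      (⟨y, k.comp ((trivializationAt F
        (fun x : M => TangentSpace 𝓘(ℝ, F) x) x).continuousLinearMapAt ℝ y)⟩ :
        CotangentBundle 𝓘(ℝ, F) M) = (y, k) := by
  rw [hom_trivializationAt_apply]
  congr 1
  ext u
  rw [ContinuousLinearMap.inCoordinates_eq hy (mem_univ _)]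
  refine congrArg k ?_
  set e := trivializationAt F (fun x : M => TangentSpace 𝓘(ℝ, F) x) x
  exact (congrFun (e.coe_continuousLinearEquivAt_eq (R := ℝ) hy).symm _).trans
    ((e.continuousLinearEquivAt ℝ y hy).apply_symm_apply u)

/-- Covectors that converge in the trivialization at `x` converge in the cotangent bundle. -/
theorem tendsto_cotangentBundle_mk {x : M} {m : ℕ → M} (hm : Tendsto m atTop (𝓝 x))
    {l : ℕ → F →L[ℝ] ℝ} {l' : F →L[ℝ] ℝ} (hl : Tendsto l atTop (𝓝 l')) :
    Tendsto (fun n => (⟨m n, (l n).comp ((trivializationAt F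
        (fun x : M => TangentSpace 𝓘(ℝ, F) x) x).continuousLinearMapAt ℝ (m n))⟩ :
        CotangentBundle 𝓘(ℝ, F) M)) atTop
      (𝓝 (⟨x, l'.comp ((trivializationAt F
        (fun x : M => TangentSpace 𝓘(ℝ, F) x) x).continuousLinearMapAt ℝ x)⟩ :
        CotangentBundle 𝓘(ℝ, F) M)) := by
  have hx := FiberBundle.mem_baseSet_trivializationAt F (fun x : M => TangentSpace 𝓘(ℝ, F) x) x
  rw [(trivializationAt (F →L[ℝ] ℝ) (fun q : M => TangentSpace 𝓘(ℝ, F) q →L[ℝ] ℝ)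
    x).tendsto_nhds_iff, trivializationAt_cotangentBundle_mk hx]
  · refine ⟨hm, hl.congr' ?_⟩
    filter_upwards [hm.eventually ((trivializationAt F
      (fun x : M => TangentSpace 𝓘(ℝ, F) x) x).open_baseSet.mem_nhds hx)] with n hn
    rw [trivializationAt_cotangentBundle_mk hn]
  · rw [Bundle.Trivialization.mem_source]
    exact FiberBundle.mem_baseSet_trivializationAt _ _ _

end NormalCone

section Curve

variable {F : Type*} [NormedAddCommGroup F] [NormedSpace ℝ F]
  {M : Type*} [TopologicalSpace M] [ChartedSpace F M] [IsManifold 𝓘(ℝ, F) 1 M]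

/-- The velocity of a smooth curve, read in the chart at its base point. -/
theorem IsSmoothCurveWithVelocity.hasDerivAt_extChartAt_comp {c : ℝ → M} {q : M}
    {v : TangentSpace 𝓘(ℝ, F) q} (hc : IsSmoothCurveWithVelocity 𝓘(ℝ, F) c q v) :
    HasDerivAt (fun t => extChartAt 𝓘(ℝ, F) q (c t)) ((trivializationAt F
        (fun x : M => TangentSpace 𝓘(ℝ, F) x) q).continuousLinearMapAt ℝ q v) 0 := by
  obtain ⟨hsm, hv⟩ := hc
  obtain rfl : c 0 = q := congrArg Bundle.TotalSpace.proj hv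
  obtain rfl : mfderiv 𝓘(ℝ, ℝ) 𝓘(ℝ, F) c 0 (1 : ℝ) = v :=
    eq_of_heq (Bundle.TotalSpace.mk.inj hv).2
  rw [TangentBundle.continuousLinearMapAt_trivializationAt (mem_chart_source F (c 0))]
  have h1 := (mdifferentiableAt_extChartAt (I := 𝓘(ℝ, F)) (mem_chart_source F (c 0))).hasMFDerivAt
  have h2 := (hsm.mdifferentiable (by simp) 0).hasMFDerivAt
  have h3 : HasFDerivAt (𝕜 := ℝ) (E := ℝ) (F := F) (fun t => extChartAt 𝓘(ℝ, F) (c 0) (c t))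
      (show ℝ →L[ℝ] F from (mfderiv 𝓘(ℝ, F) 𝓘(ℝ, F) (extChartAt 𝓘(ℝ, F) (c 0)) (c 0)).comp
        (mfderiv 𝓘(ℝ, ℝ) 𝓘(ℝ, F) c 0)) 0 := (h1.comp 0 h2).hasFDerivAt
  exact h3.hasDerivAt

end Curve

section NormalCone

variable {F : Type*} [NormedAddCommGroup F] [NormedSpace ℝ F] [FiniteDimensional ℝ F]
  {M : Type*} [TopologicalSpace M] [T2Space M] [ChartedSpace F M] [IsManifold 𝓘(ℝ, F) ∞ M]

/-- A function that is `C¹` in a chart and locally maximal on `U` yields a Fréchet normal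
to `U`. -/
theorem comp_mem_frechetSubdifferential_convexIndicator
    {U : Set M} {x m : M} (hmU : m ∈ U)
    (hm : m ∈ (chartAt F x).source) {h : F → ℝ} (hh : ContDiff ℝ 1 h)
    (hmax : ∀ᶠ y in 𝓝 m, y ∈ U → h (extChartAt 𝓘(ℝ, F) x y) ≤ h (extChartAt 𝓘(ℝ, F) x m)) :
    (fderiv ℝ h (extChartAt 𝓘(ℝ, F) x m)).comp ((trivializationAt F
        (fun x : M => TangentSpace 𝓘(ℝ, F) x) x).continuousLinearMapAt ℝ m) ∈
      frechetSubdifferential 𝓘(ℝ, F) (convexIndicator U) m := by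
  -- A Fréchet subgradient requires a test function that is `C¹` on all of `M`, so the chart
  -- function is cut off by a bump supported in the chart.
  obtain ⟨f, hf⟩ := ((SmoothBumpFunction.nhds_basis_tsupport (I := 𝓘(ℝ, F)) m).mem_iff).1
    ((chartAt F x).open_source.mem_nhds hm)
  replace hf : tsupport f ⊆ (chartAt F x).source := hf.2
  set g : M → ℝ := fun y => f y • h (extChartAt 𝓘(ℝ, F) x y) with hg
  have hgh : g =ᶠ[𝓝 m] h ∘ extChartAt 𝓘(ℝ, F) x := by
    filter_upwards [f.eventuallyEq_one] with y hy
    simp [hg, hy]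
  refine ⟨by simp [convexIndicator, hmU], g, ?_, ?_, ?_⟩
  · refine contMDiff_of_tsupport fun y hy => ?_
    have hy' := hf (tsupport_smul_subset_left f _ hy)
    exact (f.contMDiffAt.of_le (by norm_cast)).smul
      (hh.contMDiff.contMDiffAt.comp y (contMDiffAt_extChartAt' hy'))
  · rw [TangentBundle.continuousLinearMapAt_trivializationAt hm, mvfderiv, hgh.mfderiv_eq]
    have h1 := (hh.differentiable one_ne_zero
      (extChartAt 𝓘(ℝ, F) x m)).hasFDerivAt.hasMFDerivAt.comp m
      (mdifferentiableAt_extChartAt (I := 𝓘(ℝ, F)) hm).hasMFDerivAt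
    rw [h1.mfderiv]
    rfl
  · filter_upwards [hmax, hgh] with y hy hgy
    rw [hgh.self_of_nhds, hgy]
    by_cases hyU : y ∈ U
    · simp only [convexIndicator, hyU, hmU, if_true, Function.comp_apply, zero_sub,
        EReal.neg_le_neg_iff]
      exact_mod_cast hy hyU
    · simp [convexIndicator, hyU]

end NormalCone

/-! ### From proximal normals in a chart to limiting normals and derivability on the manifold. -/

section Derivable

variable {F : Type*} [NormedAddCommGroup F] [NormedSpace ℝ F] [FiniteDimensional ℝ F]
  {M : Type*} [TopologicalSpace M] [T2Space M] [ChartedSpace F M] [IsManifold 𝓘(ℝ, F) ∞ M]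

open scoped RealInnerProductSpace

/-- Limits of unit proximal normals, computed in a Euclidean chart, are limiting normals. -/
theorem inner_comp_mem_limitingNormalCone {U K : Set M} {x : M} (hxU : x ∈ U) (hK : K ∈ 𝓝 x)
    (hKs : K ⊆ (chartAt F x).source) {y z : ℕ → EuclideanSpace ℝ (Fin (Module.finrank ℝ F))}
    {u : EuclideanSpace ℝ (Fin (Module.finrank ℝ F))}
    (hyS : ∀ n, y n ∈ (fun m => toEuclidean (extChartAt 𝓘(ℝ, F) x m)) '' (K ∩ U))
    (hproj : ∀ n, ∀ s ∈ (fun m => toEuclidean (extChartAt 𝓘(ℝ, F) x m)) '' (K ∩ U),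
      dist (z n) (y n) ≤ dist (z n) s)
    (hy : Tendsto y atTop (𝓝 (toEuclidean (extChartAt 𝓘(ℝ, F) x x))))
    (hu : Tendsto (fun n => ‖z n - y n‖⁻¹ • (z n - y n)) atTop (𝓝 u)) :
    ((innerSL ℝ u).comp (toEuclidean : F ≃L[ℝ] _).toContinuousLinearMap).comp
      ((trivializationAt F (fun x : M => TangentSpace 𝓘(ℝ, F) x) x).continuousLinearMapAt ℝ x) ∈
      limitingNormalCone 𝓘(ℝ, F) U x := by
  set E : F ≃L[ℝ] EuclideanSpace ℝ (Fin (Module.finrank ℝ F)) := toEuclidean with hE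
  set φ := extChartAt 𝓘(ℝ, F) x with hφ
  choose m hm hmy using hyS
  have hmsrc : ∀ n, m n ∈ φ.source := fun n => by
    rw [hφ, extChartAt_source]; exact hKs (hm n).1
  have hmx : Tendsto m atTop (𝓝 x) := by
    have h1 : Tendsto (fun n => φ.symm (E.symm (y n))) atTop (𝓝 (φ.symm (φ x))) := by
      refine (continuousAt_extChartAt_symm x).tendsto.comp ?_
      have h0 := (E.symm.continuous.tendsto _).comp hy
      rwa [E.symm_apply_apply] at h0
    rw [hφ, extChartAt_to_inv, ← hφ] at h1
    refine h1.congr fun n => ?_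
    rw [← hmy n, E.symm_apply_apply, φ.left_inv (hmsrc n)]
  -- The projections are onto the image of `K ∩ U` only. They give local maxima on `U` once `K` is a
  -- neighbourhood of `m n`, hence the shift by `N`.
  obtain ⟨N, hN⟩ := eventually_atTop.1 (hmx.eventually (eventually_mem_nhds_iff.2 hK))
  have hshift := tendsto_add_atTop_nat N
  set l : ℕ → F →L[ℝ] ℝ := fun n =>
    (innerSL ℝ (‖z n - y n‖⁻¹ • (z n - y n))).comp E.toContinuousLinearMap with hl
  have hlim : Tendsto l atTop (𝓝 ((innerSL ℝ u).comp E.toContinuousLinearMap)) := by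
    have : Continuous fun w : EuclideanSpace ℝ (Fin (Module.finrank ℝ F)) =>
      (innerSL ℝ w).comp E.toContinuousLinearMap := by fun_prop
    exact (this.tendsto u).comp hu
  refine ⟨fun n => m (n + N), _, fun n => ?_, hmx.comp hshift, ?_,
    tendsto_cotangentBundle_mk (hmx.comp hshift) (hlim.comp hshift)⟩
  · set k := n + N with hk
    -- The squared distance is smooth everywhere, and this scaling makes its derivative at the
    -- projection the unit normal. If `z k = y k`, the convention `0⁻¹ = 0` makes both vanish.
    set h : F → ℝ := fun w => -(2 * ‖z k - y k‖)⁻¹ * ‖z k - E w‖ ^ 2 with hh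
    have hd : HasFDerivAt h (l k) (φ (m k)) := by
      have h1 : HasFDerivAt (fun w => z k - E w) (-E.toContinuousLinearMap) (φ (m k)) :=
        E.toContinuousLinearMap.hasFDerivAt.const_sub (z k)
      convert! h1.norm_sq.const_mul (-(2 * ‖z k - y k‖)⁻¹) using 1
      ext w
      have : E (φ (m k)) = y k := hmy k
      simp [hl, this]
      ring
    have hmem := comp_mem_frechetSubdifferential_convexIndicator (U := U) (x := x) (m := m k)
      (h := h) (hm k).2 (hKs (hm k).1) 
      (contDiff_const.mul ((contDiff_const.sub E.contDiff).norm_sq ℝ)) (by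
        filter_upwards [hN k (by omega)] with w hw hwU
        have h2 := hproj k _ ⟨w, ⟨hw, hwU⟩, rfl⟩
        rw [dist_eq_norm, dist_eq_norm, ← hmy k] at h2
        have : ‖z k - E (φ (m k))‖ ^ 2 ≤ ‖z k - E (φ w)‖ ^ 2 := by gcongr
        exact mul_le_mul_of_nonpos_left this (by simp))
    rwa [hd.fderiv] at hmem
  · have : ∀ n, convexIndicator U (m n) = convexIndicator U x := fun n => by
      simp [convexIndicator, hxU, (hm n).2]
    simp [this]

/-- Clarke tangent vectors are derivable in the chart: the segment with that direction stays
within distance `o(t)` of the image of `U`. -/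
theorem eventually_infDist_image_le {U K : Set M} {x : M} (hxU : x ∈ U) (hU : IsClosed U)
    (hK : K ∈ 𝓝 x) (hKc : IsCompact K) (hKs : K ⊆ (chartAt F x).source)
    {v : TangentSpace 𝓘(ℝ, F) x} (hv : v ∈ clarkeTangentCone 𝓘(ℝ, F) U x)
    {ε : ℝ} (hε : 0 < ε) :
    IsCompact ((fun m => toEuclidean (extChartAt 𝓘(ℝ, F) x m)) '' (K ∩ U)) ∧
    ∀ᶠ t in 𝓝[>] (0 : ℝ), Metric.infDist (toEuclidean (extChartAt 𝓘(ℝ, F) x x) +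
      t • toEuclidean ((trivializationAt F (fun x : M => TangentSpace 𝓘(ℝ, F) x)
        x).continuousLinearMapAt ℝ x v))
      ((fun m => toEuclidean (extChartAt 𝓘(ℝ, F) x m)) '' (K ∩ U)) ≤ ε * t := by
  have hcpt : IsCompact ((fun m => toEuclidean (extChartAt 𝓘(ℝ, F) x m)) '' (K ∩ U)) := by
    refine (hKc.inter_right hU).image_of_continuousOn ?_
    refine toEuclidean.continuous.comp_continuousOn ((continuousOn_extChartAt x).mono ?_)
    rw [extChartAt_source]
    exact inter_subset_left.trans hKs
  refine ⟨hcpt, eventually_infDist_le_of_polar hcpt.isClosed ⟨x, ⟨mem_of_mem_nhds hK, hxU⟩, rfl⟩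
    (fun y z u hyS hproj _ hy hu => ?_) hε⟩
  exact hv _ (inner_comp_mem_limitingNormalCone hxU hK hKs hyS hproj hy hu)

end Derivable

section Riemannian

variable {F : Type*} [NormedAddCommGroup F] [NormedSpace ℝ F] [FiniteDimensional ℝ F]
  {M : Type*} [EMetricSpace M] [ChartedSpace F M] [IsManifold 𝓘(ℝ, F) ∞ M]
  [Bundle.RiemannianBundle (fun x : M => TangentSpace 𝓘(ℝ, F) x)]
  [IsContinuousRiemannianBundle F (fun x : M => TangentSpace 𝓘(ℝ, F) x)]
  [IsRiemannianManifold 𝓘(ℝ, F) M]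

/-- A smooth curve whose velocity is a Clarke tangent vector to the closed set `U` stays within
distance `o(t)` of `U`. -/
theorem IsSmoothCurveWithVelocity.eventually_exists_edist_le {U : Set M} (hU : IsClosed U)
    {c : ℝ → M} {q : M} (hq : q ∈ U) {v : TangentSpace 𝓘(ℝ, F) q}
    (hv : v ∈ clarkeTangentCone 𝓘(ℝ, F) U q)
    (hc : IsSmoothCurveWithVelocity 𝓘(ℝ, F) c q v) {ε : ℝ} (hε : 0 < ε) :
    ∀ᶠ t in 𝓝[>] (0 : ℝ), ∃ y ∈ U, edist y (c t) ≤ ENNReal.ofReal (ε * t) := by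
  have : LocallyCompactSpace M := Manifold.locallyCompact_of_finiteDimensional 𝓘(ℝ, F)
  obtain ⟨C, s, hs, hC⟩ := exists_edist_le_edist_extChartAt (F := F) q
  obtain ⟨K, hK, hKss, hKc⟩ := local_compact_nhds
    (inter_mem hs ((chartAt F q).open_source.mem_nhds (mem_chart_source F q)))
  set E : F ≃L[ℝ] EuclideanSpace ℝ (Fin (Module.finrank ℝ F)) := toEuclidean with hE
  set φ := extChartAt 𝓘(ℝ, F) q with hφ
  set w := (trivializationAt F (fun x : M => TangentSpace 𝓘(ℝ, F) x)
    q).continuousLinearMapAt ℝ q v with hw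
  obtain ⟨D, hD⟩ : ∃ D : ℝ≥0, LipschitzWith D E.symm := ⟨_, E.symm.lipschitz⟩
  -- The projection and the linearization of the curve each cost `η * t`, and returning to `M`
  -- multiplies by `C * D`. The `+ 1` keeps the denominator positive.
  have hη : 0 < ε / (2 * (C * D + 1)) := by positivity
  set η := ε / (2 * (C * D + 1)) with hηdef
  obtain ⟨hcpt, hinf⟩ := eventually_infDist_image_le hq hU hK hKc
    (hKss.trans inter_subset_right) hv hη
  have hc0 : c 0 = q := congrArg Bundle.TotalSpace.proj hc.2
  have hder : HasDerivAt (fun t => E (φ (c t))) (E w) 0 :=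
    E.hasFDerivAt.comp_hasDerivAt 0 hc.hasDerivAt_extChartAt_comp
  have hlin : ∀ᶠ t in 𝓝 (0 : ℝ), ‖E (φ (c t)) - E (φ (c 0)) - (t - 0) • E w‖ ≤ η * ‖t - 0‖ :=
    (hasDerivAt_iff_isLittleO.1 hder).def hη
  have hct : ∀ᶠ t in 𝓝 (0 : ℝ), c t ∈ s :=
    hc.1.continuous.continuousAt.eventually (by rwa [hc0])
  filter_upwards [hinf, nhdsWithin_le_nhds hlin, nhdsWithin_le_nhds hct, self_mem_nhdsWithin]
    with t ht1 ht2 ht3 (ht4 : 0 < t)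
  obtain ⟨_, ⟨m, ⟨hmK, hmU⟩, rfl⟩, hm⟩ := hcpt.exists_infDist_eq_dist
    ⟨_, q, ⟨mem_of_mem_nhds hK, hq⟩, rfl⟩ (E (φ q) + t • E w)
  refine ⟨m, hmU, (hC m (hKss hmK).1 (c t) ht3).trans ?_⟩
  rw [hm] at ht1
  rw [sub_zero, hc0, Real.norm_of_nonneg ht4.le, sub_sub, ← dist_eq_norm] at ht2
  have h3 : dist (E (φ m)) (E (φ (c t))) ≤ 2 * η * t := by
    rw [dist_comm] at ht2
    have ht1 : dist (E (φ q) + t • E w) (E (φ m)) ≤ η * t := ht1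
    linarith [dist_triangle_left (E (φ m)) (E (φ (c t))) (E (φ q) + t • E w)]
  have h4 : dist (φ m) (φ (c t)) ≤ D * (2 * η * t) := by
    have := hD.dist_le_mul (E (φ m)) (E (φ (c t)))
    rw [E.symm_apply_apply, E.symm_apply_apply] at this
    exact this.trans (by gcongr)
  rw [edist_dist, ← ENNReal.ofReal_coe_nnreal, ← ENNReal.ofReal_mul C.coe_nonneg]
  refine ENNReal.ofReal_le_ofReal ?_
  calc (C : ℝ) * dist (φ m) (φ (c t)) ≤ C * (D * (2 * η * t)) := by gcongr
    _ = (C * D / (C * D + 1)) * (ε * t) := by rw [hηdef]; field_simp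
    _ ≤ 1 * (ε * t) := by
        gcongr
        rw [div_le_one (by positivity)]
        linarith
    _ = ε * t := one_mul _

end Riemannian

/-! ### Penalized minimization and the error bound. -/

section Decrease

variable {F : Type*} [NormedAddCommGroup F] [NormedSpace ℝ F] [FiniteDimensional ℝ F]
  {M : Type*} [EMetricSpace M] [ChartedSpace F M] [IsManifold 𝓘(ℝ, F) ∞ M]
  [Bundle.RiemannianBundle (fun x : M => TangentSpace 𝓘(ℝ, F) x)]
  [IsContinuousRiemannianBundle F (fun x : M => TangentSpace 𝓘(ℝ, F) x)]
  [IsRiemannianManifold 𝓘(ℝ, F) M]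

/-- If `x` minimizes `f + Δ' d(·, x)` locally on `U`, then `f` cannot decrease at a rate larger
than `Δ'` in a Clarke tangent direction. -/
theorem decrease_rate_le_of_local_min {U : Set M} (hU : IsClosed U) {f : M → ℝ} {x : M}
    (hx : x ∈ U) (hf0 : ∀ y, 0 ≤ f y) {K : ℝ≥0} {s : Set M} (hs : s ∈ 𝓝 x)
    (hf : LipschitzOnWith K f s)
    {v : TangentSpace 𝓘(ℝ, F) x} (hv : v ∈ clarkeTangentCone 𝓘(ℝ, F) U x) (hv0 : v ≠ 0)
    {c : ℝ → M} (hc : IsSmoothCurveWithVelocity 𝓘(ℝ, F) c x v) {Δ Δ' : ℝ}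
    (hdini : lowerDiniAlong f c ≤ ((-(Δ * ‖v‖) : ℝ) : EReal)) (hΔ' : 0 ≤ Δ')
    (hmin : ∀ᶠ y in 𝓝 x, y ∈ U →
      ENNReal.ofReal (f x) ≤ ENNReal.ofReal (f y) + ENNReal.ofReal Δ' * edist y x) :
    Δ ≤ Δ' := by
  by_contra! hlt
  have hvpos : 0 < ‖v‖ := norm_pos_iff.2 hv0
  -- Replacing `c t` by a nearby `y ∈ U` costs `K * ε` in slope. The distance from `y` to `x` is at
  -- most `(‖v‖ + 2 * ε) * t`, with one `ε` for `y` and one for the speed of `c`. This `ε` keeps the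
  -- total excess `(K + 2 * Δ') * ε` below `(Δ - Δ') * ‖v‖`.
  have hε : 0 < (Δ - Δ') * ‖v‖ / (2 * (K + 2 * Δ' + 1)) :=
    div_pos (mul_pos (sub_pos.2 hlt) hvpos) (by positivity)
  set ε := (Δ - Δ') * ‖v‖ / (2 * (K + 2 * Δ' + 1)) with hεdef
  have hεeq : ε * (K + 2 * Δ' + 1) = (Δ - Δ') * ‖v‖ / 2 := by
    rw [hεdef]; field_simp
  have hc0 : c 0 = x := congrArg Bundle.TotalSpace.proj hc.2
  obtain ⟨r, hr, hball⟩ := EMetric.mem_nhds_iff.1 (inter_mem hs hmin)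
  have hsmall : ∀ᶠ t in 𝓝[>] (0 : ℝ), ENNReal.ofReal ((‖v‖ + 2 * ε) * t) < r := by
    have : Tendsto (fun t : ℝ => ENNReal.ofReal ((‖v‖ + 2 * ε) * t)) (𝓝 0) (𝓝 0) := by
      have h : Continuous fun t : ℝ => ENNReal.ofReal ((‖v‖ + 2 * ε) * t) :=
        ENNReal.continuous_ofReal.comp (by fun_prop)
      simpa using h.tendsto 0
    exact nhdsWithin_le_nhds (this.eventually_lt_const hr)
  have hct : ∀ᶠ t in 𝓝 (0 : ℝ), c t ∈ s :=
    hc.1.continuous.continuousAt.eventually (by rwa [hc0])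
  have hlow : ∀ᶠ t in 𝓝[>] (0 : ℝ),
      ((-(K * ε + Δ' * (‖v‖ + 2 * ε)) : ℝ) : EReal) ≤ (((f (c t) - f (c 0)) / t : ℝ) : EReal) := by
    filter_upwards [hc.eventually_exists_edist_le hU hx hv hε,
      hc.eventually_edist_le (lt_add_of_pos_right ‖v‖ hε), hsmall,
      nhdsWithin_le_nhds hct,
      self_mem_nhdsWithin] with t ⟨y, hyU, hyc⟩ hcx hr' hcs (ht : 0 < t)
    have hyx : edist y x ≤ ENNReal.ofReal ((‖v‖ + 2 * ε) * t) := by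
      refine (edist_triangle y (c t) x).trans ((add_le_add hyc hcx).trans ?_)
      rw [← ENNReal.ofReal_add (by positivity) (by positivity)]
      exact ENNReal.ofReal_le_ofReal (by linarith)
    obtain ⟨hys, hym⟩ := hball (show y ∈ Metric.eball x r from hyx.trans_lt hr')
    have h1 : f y ≤ f (c t) + K * (ε * t) := by
      have h := (hf hys hcs).trans (mul_le_mul_right hyc (K : ℝ≥0∞))
      rw [edist_dist, ← ENNReal.ofReal_coe_nnreal, ← ENNReal.ofReal_mul K.coe_nonneg,
        ENNReal.ofReal_le_ofReal_iff (by positivity)] at h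
      linarith [(abs_le.1 h).2]
    have h2 : f x ≤ f y + Δ' * ((‖v‖ + 2 * ε) * t) := by
      have h := (hym hyU).trans (add_le_add_right (mul_le_mul_right hyx (ENNReal.ofReal Δ')) _)
      rw [← ENNReal.ofReal_mul hΔ', ← ENNReal.ofReal_add (hf0 y) (by positivity),
        ENNReal.ofReal_le_ofReal_iff (add_nonneg (hf0 y) (by positivity))] at h
      exact h
    rw [EReal.coe_le_coe_iff, le_div_iff₀ ht, hc0]
    linarith
  have hfin := (le_liminf_of_le (by isBoundedDefault) hlow).trans hdini
  rw [EReal.coe_le_coe_iff] at hfin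
  linarith [mul_pos (sub_pos.2 hlt) hvpos]

variable {X : Type*} [MetricSpace X]

/-- Near `(e₀, q₀)`, any rate smaller than the decrease rate yields an error bound. -/
theorem StrongDecrease.exists_zero_le {P : X → M → ℝ} {U : Set M} (hU : IsClosed U)
    (hP_nonneg : ∀ e q, 0 ≤ P e q) (hP_cont : Continuous (fun z : X × M => P z.1 z.2))
    {e₀ : X} {q₀ : M} (hq₀ : q₀ ∈ zeroSet P U e₀)
    (hP_lip : ∀ᶠ z : X × M in 𝓝 (e₀, q₀), ∃ K : ℝ≥0, ∃ t ∈ 𝓝 z.2, LipschitzOnWith K (P z.1) t)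
    {Δ : ℝ} (hP_decr : StrongDecrease 𝓘(ℝ, F) P U e₀ q₀ Δ) :
    ∀ᶠ z : X × M in 𝓝 (e₀, q₀), z.2 ∈ U → ∀ Δ' ∈ Ico (Δ / 2) Δ,
      ∃ a ∈ zeroSet P U z.1, ENNReal.ofReal Δ' * edist a z.2 ≤ ENNReal.ofReal (P z.1 z.2) := by
  have : LocallyCompactSpace M := Manifold.locallyCompact_of_finiteDimensional 𝓘(ℝ, F)
  obtain ⟨hΔ, ε, hε, hdecr⟩ := hP_decr
  obtain ⟨K, hKc, hK⟩ := exists_compact_mem_nhds q₀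
  have hdist : ∀ᶠ z : X × M in 𝓝 (e₀, q₀), edist z.2 q₀ + edist z.1 e₀ < ENNReal.ofReal ε := by
    have h : Continuous fun z : X × M => edist z.2 q₀ + edist z.1 e₀ := by fun_prop
    exact h.continuousAt.eventually_lt_const (by simpa using hε)
  have hKe : ∀ᶠ z : X × M in 𝓝 (e₀, q₀), z.2 ∈ K := continuous_snd.continuousAt.eventually hK
  obtain ⟨ρ, hρ, hball⟩ : ∃ ρ : ℝ≥0∞, 0 < ρ ∧ ∀ e q, edist e e₀ < ρ →
      edist q q₀ < ρ → edist q q₀ + edist e e₀ < ENNReal.ofReal ε ∧ q ∈ K ∧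
        ∃ L : ℝ≥0, ∃ t ∈ 𝓝 q, LipschitzOnWith L (P e) t := by
    obtain ⟨ρ, hρ, hball⟩ := EMetric.mem_nhds_iff.1 (hdist.and (hKe.and hP_lip))
    refine ⟨ρ, hρ, fun e q he hq => @hball (e, q) ?_⟩
    rw [Metric.mem_eball, Prod.edist_eq]
    exact max_lt he hq
  have hρ2 : 0 < ρ / 2 := ENNReal.half_pos hρ.ne'
  -- This threshold forces the minimizer within `ρ / 2` of `q` for all `Δ' ≥ Δ / 2` at once, so the
  -- neighbourhood does not depend on `Δ'`.
  have hP0 : ∀ᶠ z : X × M in 𝓝 (e₀, q₀),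
      ENNReal.ofReal (P z.1 z.2) < ENNReal.ofReal (Δ / 2) * (ρ / 2) := by
    refine (ENNReal.continuous_ofReal.comp hP_cont).continuousAt.eventually_lt_const ?_
    simp only [Function.comp_apply, hq₀.2, ENNReal.ofReal_zero]
    exact ENNReal.mul_pos (by simpa using hΔ) hρ2.ne'
  filter_upwards [hP0, continuous_fst.continuousAt.eventually (Metric.eball_mem_nhds e₀ hρ),
    continuous_snd.continuousAt.eventually (Metric.eball_mem_nhds q₀ hρ2)]
  rintro ⟨e, q⟩ hPz (he : edist e e₀ < ρ) (hq : edist q q₀ < ρ / 2) hqU Δ' ⟨hΔ'1, hΔ'2⟩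
  simp only at hPz hqU ⊢
  have hΔ'0 : 0 < Δ' := by linarith
  have hfc : Continuous (P e) := hP_cont.comp (by fun_prop : Continuous fun x : M => (e, x))
  have hgc : Continuous fun y => ENNReal.ofReal (P e y) + ENNReal.ofReal Δ' * edist y q :=
    (ENNReal.continuous_ofReal.comp hfc).add
      ((ENNReal.continuous_const_mul ENNReal.ofReal_ne_top).comp (by fun_prop))
  have hqK : q ∈ K := (hball e q he (hq.trans_le ENNReal.half_le_self)).2.1
  obtain ⟨x, ⟨hxK, hxU⟩, hxmin⟩ := (hKc.inter_right hU).exists_isMinOn ⟨q, hqK, hqU⟩ hgc.continuousOn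
  have hxq : ENNReal.ofReal (P e x) + ENNReal.ofReal Δ' * edist x q ≤ ENNReal.ofReal (P e q) := by
    simpa using isMinOn_iff.1 hxmin q ⟨hqK, hqU⟩
  have hxq' : ENNReal.ofReal Δ' * edist x q ≤ ENNReal.ofReal (P e q) := le_add_self.trans hxq
  have hd : edist x q < ρ / 2 := by
    have : ENNReal.ofReal Δ' * edist x q < ENNReal.ofReal Δ' * (ρ / 2) :=
      (hxq'.trans_lt hPz).trans_le (mul_le_mul_left (ENNReal.ofReal_le_ofReal hΔ'1) _)
    exact lt_of_mul_lt_mul_left' this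
  have hxq₀ : edist x q₀ < ρ :=
    (edist_triangle x q q₀).trans_lt ((ENNReal.add_lt_add hd hq).trans_eq (ENNReal.add_halves ρ))
  refine ⟨x, ⟨hxU, ?_⟩, hxq'⟩
  by_contra hne
  obtain ⟨hxε, -, L, t, ht, hL⟩ := hball e x he hxq₀
  obtain ⟨v, hv, hv0, c, hc, hdini⟩ :=
    hdecr e x hxU (lt_of_le_of_ne (hP_nonneg e x) (Ne.symm hne)) hxε
  refine (decrease_rate_le_of_local_min hU hxU (hP_nonneg e) ht hL hv hv0 hc hdini hΔ'0.le
    ?_).not_gt hΔ'2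
  -- Near `x`, points of `U` lie in `K` and compete with `x`. The triangle inequality through `x`
  -- moves the penalty's centre from `q` to `x`, after cancelling the finite term `Δ' * d(x, q)`.
  filter_upwards [Metric.isOpen_eball.mem_nhds (show x ∈ Metric.eball q₀ ρ from hxq₀)] with y hy hyU
  have hmin := isMinOn_iff.1 hxmin y ⟨(hball e y he hy).2.1, hyU⟩
  have hfin : ENNReal.ofReal Δ' * edist x q ≠ ⊤ :=
    ENNReal.mul_ne_top ENNReal.ofReal_ne_top (hd.trans_le le_top).ne
  refine (ENNReal.add_le_add_iff_right hfin).1 (hmin.trans ?_)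
  rw [add_assoc, ← mul_add]
  gcongr
  exact edist_triangle y x q

end Decrease

end NonsmoothManifold

theorem mainTheorem3
    {F : Type*} [NormedAddCommGroup F] [NormedSpace ℝ F] [FiniteDimensional ℝ F]
    {M : Type*} [EMetricSpace M] [ChartedSpace F M] [IsManifold 𝓘(ℝ, F) ∞ M]
    [Bundle.RiemannianBundle (fun x : M => TangentSpace 𝓘(ℝ, F) x)]
    [IsContMDiffRiemannianBundle 𝓘(ℝ, F) ∞ F (fun x : M => TangentSpace 𝓘(ℝ, F) x)]
    [IsRiemannianManifold 𝓘(ℝ, F) M]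
    {X : Type*} [MetricSpace X]
    (U : Set M) (hU : IsClosed U)
    (P : X → M → ℝ) (hP_nonneg : ∀ e q, 0 ≤ P e q)
    (hP_cont : Continuous (fun z : X × M => P z.1 z.2))
    (e₀ : X) (q₀ : M) (hq₀ : q₀ ∈ NonsmoothManifold.zeroSet P U e₀)
    -- for `(e, q)` near `(e₀, q₀)`, the function `P e` is Lipschitz on a neighbourhood of `q`
    (hP_lip : ∀ᶠ z : X × M in 𝓝 (e₀, q₀),
      ∃ K : ℝ≥0, ∃ t ∈ 𝓝 z.2, LipschitzOnWith K (P z.1) t)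
    (Δ : ℝ) (hP_decr : NonsmoothManifold.StrongDecrease 𝓘(ℝ, F) P U e₀ q₀ Δ) :
    (∃ O ∈ 𝓝 (e₀, q₀), ∀ (e : X) (q : M), (e, q) ∈ O → q ∈ U →
      (NonsmoothManifold.zeroSet P U e).Nonempty ∧
      Metric.infEDist q (NonsmoothManifold.zeroSet P U e) ≤ ENNReal.ofReal (1 / Δ * P e q)) ∧
    (∀ᶠ e in 𝓝 e₀, (NonsmoothManifold.zeroSet P U e).Nonempty) := by
  have hΔ : 0 < Δ := hP_decr.1
  have : IsContinuousRiemannianBundle F (fun x : M => TangentSpace 𝓘(ℝ, F) x) := by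
    obtain ⟨g, hg, hgi⟩ := IsContMDiffRiemannianBundle.exists_contMDiff (IB := 𝓘(ℝ, F)) (n := ∞)
      (F := F) (E := fun x : M => TangentSpace 𝓘(ℝ, F) x)
    exact ⟨g, hg.continuous, hgi⟩
  have hO := hP_decr.exists_zero_le hU hP_nonneg hP_cont hq₀ hP_lip
  have hhalf : Δ / 2 ∈ Ico (Δ / 2) Δ := ⟨le_rfl, half_lt_self hΔ⟩
  refine ⟨⟨_, hO, fun e q hz hqU => ⟨?_, ?_⟩⟩, ?_⟩
  · obtain ⟨a, ha, -⟩ := hz hqU (Δ / 2) hhalf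
    exact ⟨a, ha⟩
  -- The zeros found may vary with the rate `r`, but the infimum distance does not, so the bound
  -- survives `r ↑ Δ`.
  · have hlim : Tendsto (fun r : ℝ => ENNReal.ofReal (1 / r * P e q)) (𝓝[<] Δ)
        (𝓝 (ENNReal.ofReal (1 / Δ * P e q))) := by
      refine (ENNReal.continuous_ofReal.tendsto _).comp (Tendsto.mul_const _ ?_)
      exact (tendsto_const_nhds.div tendsto_id hΔ.ne').mono_left nhdsWithin_le_nhds
    refine ge_of_tendsto hlim ?_
    filter_upwards [Ico_mem_nhdsLT (half_lt_self hΔ)] with r hr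
    have hr0 : 0 < r := (half_pos hΔ).trans_le hr.1
    obtain ⟨a, ha, hle⟩ := hz hqU r hr
    refine (Metric.infEDist_le_edist_of_mem ha).trans ?_
    rw [one_div_mul_eq_div, ENNReal.ofReal_div_of_pos hr0, edist_comm,
      ENNReal.le_div_iff_mul_le (by simp [hr0]) (by simp), mul_comm]
    exact hle
  · have hc : Tendsto (fun e : X => (e, q₀)) (𝓝 e₀) (𝓝 (e₀, q₀)) :=
      (by fun_prop : Continuous fun e : X => (e, q₀)).tendsto e₀
    filter_upwards [hc.eventually hO] with e he
    obtain ⟨a, ha, -⟩ := he hq₀.1 (Δ / 2) hhalf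
    exact ⟨a, ha⟩
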